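/- Let $\Gamma=(X,R)$ be a finite bipartite distance-regular graph with path-length distance $\partial$, diameter $D\ge 4$, valency $k\ge 3$ and intersection numbers $p^h_{ij}$ (for $\partial(x,y)=h$, the number of $z\in X$ with $\partial(x,z)=i$ and $\partial(z,y)=j$); write $b_i=p^i_{1,i+1}$ and $d=\lfloor D/2\rfloor$. For $0\le i\le D$ let $A_i\in \mathrm{Mat}_X(\mathbb C)$ be the $i$-th distance matrix, with $(y,z)$-entry $1$ if $\partial(y,z)=i$ and $0$ otherwise. Let $A=A_1$ be the adjacency matrix, $M$ the subalgebra of $\mathrm{Mat}_X(\mathbb C)$ generated by $A$, $\theta_0>\theta_1>\cdots>\theta_D$ the distinct eigenvalues of $A$, and $E_i$ the orthogonal projection of $\mathbb C^X$ onto the eigenspace of $A$ for $\theta_i$. Fix $x\in X$. For $0\le i\le D$ let $E_i^*$ be the diagonal matrix with $(y,y)$-entry $1$ if $\partial(x,y)=i$ and $0$ otherwise, and let $T$ be the subalgebra of $\mathrm{Mat}_X(\mathbb C)$ generated by $M$ and $E_0^*,\dots,E_D^*$. A $T$-module is a $T$-invariant subspace of $\mathbb C^X$; it is irreducible if it is nonzero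 and contains no $T$-modules other than $0$ and itself. An irreducible $T$-module $W$ is thin if $\dim E_i^*W\le 1$ for $0\le i\le D$, and its endpoint is $\min\{i : 0\le i\le D,\ E_i^*W\neq 0\}$. If $W$ is thin and irreducible with endpoint $2$, then the one-dimensional space $E_2^*W$ is spanned by an eigenvector of $E_2^*A_2E_2^*$, and the corresponding eigenvalue is called the local eigenvalue of $W$. Let $n\in\{1,d\}$ if $D$ is odd, and let $n=1$ if $D$ is even. Put $$\tilde\theta_n=-1-\frac{b_2b_3}{\theta_n^2-b_2},$$ where the denominator is nonzero because $\theta_1^2>b_2>\theta_d^2$. **Theorem.** Let $W$ be a thin irreducible $T$-module with endpoint $2$ and local eigenvalue $\tilde\theta_n$, and let $v$ be a nonzero vector in $E_2^*W$. Then $W=Mv$. Moreover, the vectors $$E_iv\qquad(1\le i\le D-1,\ i\ne n,\ i\ne D-n)$$ form a basis of $W$, and $E_0v=0$, $E_nv=0$, $E_{D-n}v=0$, $E_Dv=0$. -/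

import Mathlib

open scoped Matrix

namespace DRG

noncomputable section

/-- A finite graph is distance-regular if it is connected and, for all `h, i, j` between `0` and
the diameter, the number of `z` with `∂(x,z) = i` and `∂(z,y) = j` is the same for all pairs `x, y`
at distance `h`. -/
def IsDistanceRegular {X : Type*} [Fintype X] (G : SimpleGraph X) : Prop :=
  G.Connected ∧ ∀ h i j : ℕ, h ≤ G.diam → i ≤ G.diam → j ≤ G.diam →
    ∃ p : ℕ, ∀ x y : X, G.dist x y = h →
      (Finset.univ.filter fun z : X => G.dist x z = i ∧ G.dist z y = j).card = p

/-- The intersection number `p^h_{ij}`: the maximum, over the pairs `x, y` at distance `h`, of the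
number of `z` with `∂(x,z) = i` and `∂(z,y) = j`. In a distance-regular graph it is the common
value of all these numbers. -/
def intersectionNumber {X : Type*} [Fintype X] (G : SimpleGraph X) (h i j : ℕ) : ℕ :=
  (Finset.univ.filter fun q : X × X => G.dist q.1 q.2 = h).sup fun q =>
    (Finset.univ.filter fun z : X => G.dist q.1 z = i ∧ G.dist z q.2 = j).card

/-- The intersection number `b_i = p^i_{1,i+1}`. -/
def b {X : Type*} [Fintype X] (G : SimpleGraph X) (i : ℕ) : ℕ :=
  intersectionNumber G i 1 (i + 1)

/-- The `i`-th distance matrix `A_i`. -/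
def distMatrix {X : Type*} (G : SimpleGraph X) (i : ℕ) : Matrix X X ℂ :=
  Matrix.of fun y z => if G.dist y z = i then 1 else 0

/-- The adjacency matrix `A = A_1`. -/
def adjacency {X : Type*} (G : SimpleGraph X) : Matrix X X ℂ :=
  distMatrix G 1

/-- The finite set of the real eigenvalues of `A`. Since `A` is real symmetric, these are all its
eigenvalues. -/
def eigenvalueSet {X : Type*} [Fintype X] [DecidableEq X] (G : SimpleGraph X) : Finset ℝ :=
  Set.Finite.toFinset (s := {t : ℝ |
      Module.End.HasEigenvalue (Matrix.toLin' (adjacency G)) (t : ℂ)})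
    (Set.Finite.preimage Complex.ofReal_injective.injOn
      (Module.End.finite_hasEigenvalue (Matrix.toLin' (adjacency G))))

/-- `θ_i`: the `i`-th entry (from `i = 0`) of the list of the distinct eigenvalues of `A` in
decreasing order. A distance-regular graph of diameter `D` has exactly `D + 1` of them; the value
past the end of the list is irrelevant. -/
def eigenvalue {X : Type*} [Fintype X] [DecidableEq X] (G : SimpleGraph X) (i : ℕ) : ℝ :=
  ((eigenvalueSet G).sort (· ≥ ·)).getD i 0

/-- The primitive idempotent `E_i`: the matrix of the orthogonal projection of the Hermitian space
`ℂ^X` onto the eigenspace of `A` for `θ_i`. -/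
def primitiveIdempotent {X : Type*} [Fintype X] [DecidableEq X] (G : SimpleGraph X) (i : ℕ) :
    Matrix X X ℂ :=
  Matrix.toEuclideanLin.symm
    ((Module.End.eigenspace (Matrix.toEuclideanLin (adjacency G))
      (eigenvalue G i : ℂ)).starProjection : EuclideanSpace ℂ X →ₗ[ℂ] EuclideanSpace ℂ X)

/-- The `i`-th dual idempotent `E*_i = E*_i(x)`. -/
def dualIdempotent {X : Type*} [DecidableEq X] (G : SimpleGraph X) (x : X) (i : ℕ) :
    Matrix X X ℂ :=
  Matrix.diagonal fun y => if G.dist x y = i then 1 else 0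

/-- The Bose-Mesner algebra `M`, generated by `A`. -/
def boseMesner {X : Type*} [Fintype X] [DecidableEq X] (G : SimpleGraph X) :
    Subalgebra ℂ (Matrix X X ℂ) :=
  Algebra.adjoin ℂ {adjacency G}

/-- The dual Bose-Mesner algebra `M* = M*(x)`, generated by the dual idempotents
(`E*_i = 0` for `i > D`). -/
def dualBoseMesner {X : Type*} [Fintype X] [DecidableEq X] (G : SimpleGraph X) (x : X) :
    Subalgebra ℂ (Matrix X X ℂ) :=
  Algebra.adjoin ℂ (Set.range (dualIdempotent G x))

/-- The subconstituent (Terwilliger) algebra `T = T(x)`, generated by `M` and `M*`. -/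
def subconstituentAlgebra {X : Type*} [Fintype X] [DecidableEq X] (G : SimpleGraph X) (x : X) :
    Subalgebra ℂ (Matrix X X ℂ) :=
  boseMesner G ⊔ dualBoseMesner G x

/-- A `T`-module: a subspace of `ℂ^X` invariant under `T`. -/
def IsTModule {X : Type*} [Fintype X] [DecidableEq X] (G : SimpleGraph X) (x : X)
    (W : Submodule ℂ (X → ℂ)) : Prop :=
  ∀ B ∈ subconstituentAlgebra G x, ∀ w ∈ W, B *ᵥ w ∈ W

/-- An irreducible `T`-module. -/
def IsIrreducibleTModule {X : Type*} [Fintype X] [DecidableEq X] (G : SimpleGraph X) (x : X)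
    (W : Submodule ℂ (X → ℂ)) : Prop :=
  IsTModule G x W ∧ W ≠ ⊥ ∧
    ∀ W' : Submodule ℂ (X → ℂ), IsTModule G x W' → W' ≤ W → W' = ⊥ ∨ W' = W

/-- The subspace `E*_i W`. -/
def dualComponent {X : Type*} [Fintype X] [DecidableEq X] (G : SimpleGraph X) (x : X) (i : ℕ)
    (W : Submodule ℂ (X → ℂ)) : Submodule ℂ (X → ℂ) :=
  W.map (Matrix.mulVecLin (dualIdempotent G x i))

/-- `W` is thin: `dim E*_i W ≤ 1` for `0 ≤ i ≤ D`. -/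
def IsThin {X : Type*} [Fintype X] [DecidableEq X] (G : SimpleGraph X) (x : X)
    (W : Submodule ℂ (X → ℂ)) : Prop :=
  ∀ i ≤ G.diam, Module.finrank ℂ (dualComponent G x i W) ≤ 1

/-- The endpoint of `W`: the least `i` with `0 ≤ i ≤ D` and `E*_i W ≠ 0`. -/
def endpoint {X : Type*} [Fintype X] [DecidableEq X] (G : SimpleGraph X) (x : X)
    (W : Submodule ℂ (X → ℂ)) : ℕ :=
  sInf {i : ℕ | i ≤ G.diam ∧ dualComponent G x i W ≠ ⊥}

/-- `η` is the local eigenvalue of `W`: the space `E*_2 W` is nonzero and consists of eigenvectors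
(and `0`) of `E*_2 A_2 E*_2` with eigenvalue `η`. -/
def HasLocalEigenvalue {X : Type*} [Fintype X] [DecidableEq X] (G : SimpleGraph X) (x : X)
    (W : Submodule ℂ (X → ℂ)) (η : ℝ) : Prop :=
  dualComponent G x 2 W ≠ ⊥ ∧
    ∀ w ∈ dualComponent G x 2 W,
      (dualIdempotent G x 2 * distMatrix G 2 * dualIdempotent G x 2) *ᵥ w = (η : ℂ) • w

/-- The scalar `-1 - b_2 b_3 / (z ^ 2 - b_2)`, for real `z` with `z ^ 2 ≠ b_2`. In a bipartite
distance-regular graph with `D ≥ 4` and `k ≥ 3` one has `θ_1 ^ 2 > b_2 > θ_d ^ 2` for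
`d = ⌊D/2⌋`, so the denominator does not vanish at `z = θ_1` or `z = θ_d`. -/
def tilde {X : Type*} [Fintype X] (G : SimpleGraph X) (z : ℝ) : ℝ :=
  -1 - (b G 2 : ℝ) * (b G 3 : ℝ) / (z ^ 2 - (b G 2 : ℝ))

/-- The subspace `Mv = {B v : B ∈ M}`. -/
def boseMesnerSpan {X : Type*} [Fintype X] [DecidableEq X] (G : SimpleGraph X) (v : X → ℂ) :
    Submodule ℂ (X → ℂ) :=
  (Subalgebra.toSubmodule (boseMesner G)).map ((Matrix.mulVecBilin ℂ ℂ).flip v)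

end

end DRG

/-!
For a thin irreducible module `W` with endpoint `r`, raising a nonzero `v ∈ E*_r W` repeatedly gives
vectors `u_i ∈ E*_{r+i} W`; by thinness, each nonzero `u_i` spans `E*_{r+i} W`. Hence
`A u_i - u_{i+1}` is a combination of `u_0, …, u_i`, the span of the `u_i` is both `Mv` and a
`T`-submodule, and `W = Mv` by irreducibility. So `W` is spanned by the nonzero `E_i v`.

It remains to see which of these vanish. Let `r = 2`, let `t` be an eigenvalue of `A` with
projection `E`, and let `f(i)` be the entry of `E` at distance `i`. Two vertices at distance `2`
from `x` are at distance `0`, `2` or `4`, and the entries of `v` sum to `0`, so `E*_2 E v` is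
`f(0) - f(4) + η (f(2) - f(4))` times `v`, where `η` is the local eigenvalue. The three-term
recurrence for `f` shows that for `η = -1 - b_2 b_3 / (θ_n² - b_2)` this factor is a nonzero
multiple of `(θ_0² - t²) (θ_n² - t²)`. As `E` is a projection, `E v = 0` exactly when
`⟨v, E v⟩ = ⟨v, E*_2 E v⟩` vanishes, that is, when `t² = θ_0²` or `t² = θ_n²`; and the spectrum of a
bipartite graph is symmetric about `0`.

That `θ_d² < b_2 < θ_1²` follows from `∑ E_i = 1`: comparing entries at distances `2` and `4` gives
`∑ (θ_0² - t²) (t² - b_2) f_t(0) = 0` over the eigenvalues `t`, with all `f_t(0)` positive.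
-/

namespace DRG

open scoped Finset

section Combinatorics

variable {X : Type*} {G : SimpleGraph X}

theorem exists_dist_eq_one (hG : G.Connected) {y z : X} {j : ℕ} (h : G.dist y z = j + 1) :
    ∃ w, G.dist y w = 1 ∧ G.dist w z = j := by
  obtain ⟨p, hp⟩ := hG.exists_walk_length_eq_dist y z
  cases p with
  | nil => simp at h
  | @cons _ w _ hadj q =>
    have hyw : G.dist y w = 1 := SimpleGraph.dist_eq_one_iff_adj.2 hadj
    have htri : G.dist y z ≤ G.dist y w + G.dist w z := hG.dist_triangle
    have hq := SimpleGraph.dist_le q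
    rw [SimpleGraph.Walk.length_cons] at hp
    exact ⟨w, hyw, by omega⟩

theorem even_dist_iff (hG : G.Connected) (C : G.Coloring Bool) (y z : X) :
    Even (G.dist y z) ↔ (C y ↔ C z) := by
  obtain ⟨p, hp⟩ := hG.exists_walk_length_eq_dist y z
  rw [← hp, C.even_length_iff_congr]

theorem even_dist_of_dist_eq (hG : G.Connected) (hbip : G.IsBipartite) {x y z : X}
    (h : G.dist x y = G.dist x z) : Even (G.dist y z) := by
  let C : G.Coloring Bool := hbip.toColoring (by simp)
  have hxy := even_dist_iff hG C x y
  have hxz := even_dist_iff hG C x z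
  rw [even_dist_iff hG C]
  rw [h] at hxy
  tauto

theorem dist_eq_pred_or_succ (hG : G.Connected) (hbip : G.IsBipartite) {y w : X}
    (hyw : G.dist y w = 1) (z : X) :
    G.dist w z + 1 = G.dist y z ∨ G.dist w z = G.dist y z + 1 := by
  have hle : G.dist y z ≤ G.dist y w + G.dist w z := hG.dist_triangle
  have hge : G.dist w z ≤ G.dist w y + G.dist y z := hG.dist_triangle
  have hne : G.dist z y ≠ G.dist z w := fun h => by
    simpa [hyw] using even_dist_of_dist_eq hG hbip h
  rw [G.dist_comm (u := z), G.dist_comm (u := z)] at hne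
  rw [G.dist_comm (u := w) (v := y)] at hge
  omega

theorem exists_dist_eq (hG : G.Connected) {j : ℕ} (hj : j ≤ G.diam) :
    ∃ y z, G.dist y z = j := by
  have := hG.nonempty
  induction hj using Nat.decreasingInduction with
  | self => exact G.exists_dist_eq_diam
  | of_succ i _ ih =>
    obtain ⟨y, z, h⟩ := ih
    obtain ⟨w, -, hw⟩ := exists_dist_eq_one hG h
    exact ⟨w, z, hw⟩

theorem dist_le_diam [Finite X] (hG : G.Connected) (y z : X) : G.dist y z ≤ G.diam :=
  haveI : Nonempty X := ⟨y⟩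
  SimpleGraph.dist_le_diam (SimpleGraph.connected_iff_ediam_ne_top.1 hG)

variable [Fintype X]

/-- The intersection number `c_i = p^i_{1,i-1}`. For `i = 0` the truncated subtraction makes it
`p^0_{10}`, which is `0` as it should be. -/
noncomputable def c (G : SimpleGraph X) (i : ℕ) : ℕ :=
  intersectionNumber G i 1 (i - 1)

theorem IsDistanceRegular.card_eq (hG : IsDistanceRegular G) (i j : ℕ) (y z : X) :
    #{w | G.dist y w = i ∧ G.dist w z = j} = intersectionNumber G (G.dist y z) i j := by
  obtain ⟨p, hp⟩ : ∃ p, ∀ y' z', G.dist y' z' = G.dist y z →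
      #{w | G.dist y' w = i ∧ G.dist w z' = j} = p := by
    by_cases hij : i ≤ G.diam ∧ j ≤ G.diam
    · exact hG.2 _ i j (dist_le_diam hG.1 y z) hij.1 hij.2
    · refine ⟨0, fun y' z' _ => ?_⟩
      rw [Finset.card_eq_zero, Finset.filter_eq_empty_iff]
      rintro w - ⟨rfl, rfl⟩
      exact hij ⟨dist_le_diam hG.1 y' w, dist_le_diam hG.1 w z'⟩
  refine le_antisymm ?_ (Finset.sup_le fun q hq => ?_)
  · exact Finset.le_sup (s := {q : X × X | G.dist q.1 q.2 = G.dist y z})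
      (f := fun q => #{w | G.dist q.1 w = i ∧ G.dist w q.2 = j}) (b := (y, z)) (by simp)
  · rw [hp _ _ (Finset.mem_filter.1 hq).2, hp _ _ rfl]

theorem IsDistanceRegular.card_neighbors (hG : IsDistanceRegular G) (y : X) :
    #{w | G.dist y w = 1} = b G 0 := by
  have h := hG.card_eq 1 1 y y
  rw [SimpleGraph.dist_self] at h
  rw [b, ← h]
  congr 1
  ext w
  simp [G.dist_comm (u := w)]

theorem IsDistanceRegular.b_pos (hG : IsDistanceRegular G) {j : ℕ} (hj : j + 1 ≤ G.diam) :
    0 < b G j := by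
  obtain ⟨y, z, h⟩ := exists_dist_eq hG.1 hj
  obtain ⟨w, hyw, rfl⟩ := exists_dist_eq_one hG.1 h
  rw [b, ← hG.card_eq, Finset.card_pos]
  exact ⟨y, by simp [G.dist_comm (u := w) (v := y), hyw, h]⟩

theorem IsDistanceRegular.c_one (hG : IsDistanceRegular G) (hD : 1 ≤ G.diam) : c G 1 = 1 := by
  obtain ⟨y, z, h⟩ := exists_dist_eq hG.1 hD
  have hcard := hG.card_eq 1 0 y z
  rw [h] at hcard
  rw [c, Nat.sub_self, ← hcard, Finset.card_eq_one]
  refine ⟨z, Finset.ext fun w => ?_⟩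
  simp only [Finset.mem_filter, Finset.mem_univ, true_and, Finset.mem_singleton,
    hG.1.dist_eq_zero_iff]
  exact ⟨fun hw => hw.2, by rintro rfl; exact ⟨h, rfl⟩⟩

theorem IsDistanceRegular.sum_neighbors (hG : IsDistanceRegular G) (hbip : G.IsBipartite)
    {R : Type*} [CommSemiring R] (f : ℕ → R) {i : ℕ} {y z : X} (hi : G.dist y z = i) :
    ∑ w with G.dist y w = 1, f (G.dist w z) =
      (c G i : R) * f (i - 1) + (b G i : R) * f (i + 1) := by
  have hnot : ∀ w, (G.dist y w = 1 ∧ ¬G.dist w z = i - 1) ↔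
      (G.dist y w = 1 ∧ G.dist w z = i + 1) := fun w => and_congr_right fun hw => by
    have := dist_eq_pred_or_succ hG.1 hbip hw z
    omega
  have hsum : ∀ j, ∑ w with G.dist y w = 1 ∧ G.dist w z = j, f (G.dist w z) =
      (intersectionNumber G i 1 j : R) * f j := fun j => by
    rw [← hi, ← hG.card_eq, Finset.sum_congr rfl (g := fun _ => f j)
      (fun w hw => by rw [(Finset.mem_filter.1 hw).2.2]), Finset.sum_const, nsmul_eq_mul]
  rw [← Finset.sum_filter_add_sum_filter_not _ (fun w => G.dist w z = i - 1),
    Finset.filter_filter, Finset.filter_filter, Finset.filter_congr fun w _ => hnot w, hsum, hsum,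
    c, b]

theorem IsDistanceRegular.c_add_b (hG : IsDistanceRegular G) (hbip : G.IsBipartite) {i : ℕ}
    (hi : i ≤ G.diam) : c G i + b G i = b G 0 := by
  obtain ⟨y, z, h⟩ := exists_dist_eq hG.1 hi
  simpa [hG.card_neighbors] using (hG.sum_neighbors hbip (fun _ => (1 : ℕ)) h).symm

theorem IsDistanceRegular.one_add_b_one (hG : IsDistanceRegular G) (hbip : G.IsBipartite)
    (hD : 1 ≤ G.diam) : 1 + b G 1 = b G 0 := by
  rw [← hG.c_add_b hbip hD, hG.c_one hD]

end Combinatorics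

section Profile

variable {X : Type*} {G : SimpleGraph X}

/-- `B` has profile `f` if its `(y, z)`-entry is `f (∂(y, z))`, that is, if `B = ∑ f(i) A_i`; in a
distance-regular graph the matrices with a profile form the Bose-Mesner algebra. Only the values of
`f` up to the diameter matter. -/
def HasProfile (G : SimpleGraph X) (B : Matrix X X ℂ) (f : ℕ → ℂ) : Prop :=
  ∀ y z, B y z = f (G.dist y z)

variable [Fintype X]

theorem adjacency_mulVec_apply (u : X → ℂ) (y : X) :
    (adjacency G *ᵥ u) y = ∑ w with G.dist y w = 1, u w := by
  simp [Matrix.mulVec, dotProduct, adjacency, distMatrix, Finset.sum_filter]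

theorem HasProfile.mul (hG : IsDistanceRegular G) {B C : Matrix X X ℂ} {f g : ℕ → ℂ}
    (hB : HasProfile G B f) (hC : HasProfile G C g) :
    HasProfile G (B * C) fun h => ∑ p ∈ Finset.range (G.diam + 1) ×ˢ Finset.range (G.diam + 1),
      (intersectionNumber G h p.1 p.2 : ℂ) * (f p.1 * g p.2) := by
  intro y z
  rw [Matrix.mul_apply, ← Finset.sum_fiberwise_of_maps_to (g := fun w => (G.dist y w, G.dist w z))
    (fun w _ => Finset.mk_mem_product (Finset.mem_range_succ_iff.2 (dist_le_diam hG.1 y w))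
      (Finset.mem_range_succ_iff.2 (dist_le_diam hG.1 w z)))]
  refine Finset.sum_congr rfl fun p _ => ?_
  simp only [Prod.ext_iff]
  rw [← hG.card_eq, Finset.sum_congr rfl (g := fun _ => f p.1 * g p.2) fun w hw => ?_,
    Finset.sum_const, nsmul_eq_mul]
  rw [hB, hC, (Finset.mem_filter.1 hw).2.1, (Finset.mem_filter.1 hw).2.2]

theorem IsDistanceRegular.exists_hasProfile [DecidableEq X] (hG : IsDistanceRegular G)
    {B : Matrix X X ℂ} (hB : B ∈ boseMesner G) : ∃ f, HasProfile G B f := by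
  induction hB using Algebra.adjoin_induction with
  | mem B hB =>
    obtain rfl := Set.mem_singleton_iff.1 hB
    exact ⟨fun i => if i = 1 then 1 else 0, fun _ _ => rfl⟩
  | algebraMap a =>
    exact ⟨fun i => if i = 0 then a else 0, fun y z => by
      simp [Matrix.algebraMap_matrix_apply, hG.1.dist_eq_zero_iff]⟩
  | add B C _ _ hB hC =>
    obtain ⟨⟨f, hf⟩, ⟨g, hg⟩⟩ := And.intro hB hC
    exact ⟨f + g, fun y z => congrArg₂ (· + ·) (hf y z) (hg y z)⟩
  | mul B C _ _ hB hC =>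
    obtain ⟨⟨f, hf⟩, ⟨g, hg⟩⟩ := And.intro hB hC
    exact ⟨_, hf.mul hG hg⟩

end Profile

section Eigenprojection

variable {X : Type*} [Fintype X] [DecidableEq X] {A : Matrix X X ℂ}

/-- The matrix of the orthogonal projection of `ℂ^X` onto the eigenspace of `A` for `t`; it is `0`
when `t` is not an eigenvalue. The primitive idempotent `E_i` is the case of the adjacency matrix
and `t = θ_i`. -/
noncomputable def eigenprojection (A : Matrix X X ℂ) (t : ℂ) : Matrix X X ℂ :=
  Matrix.toEuclideanLin.symm
    ((Module.End.eigenspace (Matrix.toEuclideanLin A) t).starProjection :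
      EuclideanSpace ℂ X →ₗ[ℂ] EuclideanSpace ℂ X)

theorem mem_eigenspace_toEuclideanLin {t : ℂ} {w : X → ℂ} :
    WithLp.toLp 2 w ∈ Module.End.eigenspace (Matrix.toEuclideanLin A) t ↔ A *ᵥ w = t • w := by
  rw [Module.End.mem_eigenspace_iff, Matrix.toLpLin_toLp, ← WithLp.toLp_smul,
    (WithLp.toLp_injective 2).eq_iff]
  rfl

theorem toLp_eigenprojection_mulVec (A : Matrix X X ℂ) (t : ℂ) (w : X → ℂ) :
    WithLp.toLp 2 (eigenprojection A t *ᵥ w) =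
      (Module.End.eigenspace (Matrix.toEuclideanLin A) t).starProjection (WithLp.toLp 2 w) := by
  have h := Matrix.toLpLin_toLp 2 2 (eigenprojection A t) w
  rw [eigenprojection, LinearEquiv.apply_symm_apply] at h
  exact h.symm

theorem mulVec_eigenprojection_mulVec (A : Matrix X X ℂ) (t : ℂ) (w : X → ℂ) :
    A *ᵥ (eigenprojection A t *ᵥ w) = t • (eigenprojection A t *ᵥ w) := by
  rw [← mem_eigenspace_toEuclideanLin, toLp_eigenprojection_mulVec]
  exact Submodule.starProjection_apply_mem _ _

theorem eigenprojection_mulVec_of_eigenvector {t : ℂ} {w : X → ℂ} (h : A *ᵥ w = t • w) :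
    eigenprojection A t *ᵥ w = w := by
  apply WithLp.toLp_injective 2
  rw [toLp_eigenprojection_mulVec]
  exact Submodule.starProjection_eq_self_iff.2 (mem_eigenspace_toEuclideanLin.2 h)

theorem eigenprojection_mulVec_of_ne (hA : A.IsHermitian) {s t : ℂ} (hst : s ≠ t) {w : X → ℂ}
    (h : A *ᵥ w = s • w) : eigenprojection A t *ᵥ w = 0 := by
  apply WithLp.toLp_injective 2
  rw [toLp_eigenprojection_mulVec, WithLp.toLp_zero, Submodule.starProjection_apply_eq_zero_iff]
  have hortho := (Matrix.isSymmetric_toEuclideanLin_iff.2 hA).orthogonalFamily_eigenspaces.isOrtho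
    hst
  exact hortho (mem_eigenspace_toEuclideanLin.2 h)

theorem isHermitian_eigenprojection (A : Matrix X X ℂ) (t : ℂ) :
    (eigenprojection A t).IsHermitian := by
  rw [← Matrix.isSymmetric_toEuclideanLin_iff, eigenprojection, LinearEquiv.apply_symm_apply]
  exact Submodule.starProjection_isSymmetric _

theorem star_dotProduct_eigenprojection_mulVec (A : Matrix X X ℂ) (t : ℂ) (w : X → ℂ) :
    star w ⬝ᵥ (eigenprojection A t *ᵥ w) =
      star (eigenprojection A t *ᵥ w) ⬝ᵥ (eigenprojection A t *ᵥ w) := by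
  conv_lhs =>
    rw [← eigenprojection_mulVec_of_eigenvector (mulVec_eigenprojection_mulVec A t w)]
  rw [Matrix.dotProduct_mulVec, Matrix.star_mulVec, (isHermitian_eigenprojection A t).eq]

open scoped ComplexOrder in
theorem eigenprojection_mulVec_eq_zero_of_star_dotProduct {t : ℂ} {w : X → ℂ}
    (h : star w ⬝ᵥ (eigenprojection A t *ᵥ w) = 0) : eigenprojection A t *ᵥ w = 0 := by
  rw [star_dotProduct_eigenprojection_mulVec] at h
  exact dotProduct_star_self_eq_zero.1 h

omit [DecidableEq X] in
theorem ext_of_mulVec_eigenvector (hA : A.IsHermitian) {B C : Matrix X X ℂ}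
    (h : ∀ (t : ℝ) (w : X → ℂ), w ≠ 0 → A *ᵥ w = (t : ℂ) • w → B *ᵥ w = C *ᵥ w) : B = C := by
  classical
  apply Matrix.toEuclideanLin.injective
  refine hA.eigenvectorBasis.toBasis.ext fun i => ?_
  rw [OrthonormalBasis.coe_toBasis, Matrix.toLpLin_apply, Matrix.toLpLin_apply]
  refine congrArg _ (h (hA.eigenvalues i) _ (fun h0 => ?_) (hA.mulVec_eigenvectorBasis i))
  exact hA.eigenvectorBasis.orthonormal.ne_zero i (WithLp.ofLp_injective 2 h0)

theorem aeval_mulVec_of_eigenvector {t : ℂ} {w : X → ℂ} (h : A *ᵥ w = t • w)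
    (p : Polynomial ℂ) : Polynomial.aeval A p *ᵥ w = p.eval t • w := by
  have hw : Matrix.toLinAlgEquiv' A w = t • w := by rwa [Matrix.toLinAlgEquiv'_apply]
  rw [← Matrix.toLinAlgEquiv'_apply, ← Polynomial.aeval_algHom_apply]
  exact Module.End.aeval_apply_of_mem_apply_eq_smul hw

end Eigenprojection

section Spectral

variable {X : Type*} {G : SimpleGraph X}

theorem isHermitian_adjacency (G : SimpleGraph X) : (adjacency G).IsHermitian := by
  ext y z
  rw [Matrix.conjTranspose_apply, adjacency, distMatrix, Matrix.of_apply, Matrix.of_apply,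
    G.dist_comm]
  split_ifs <;> simp

variable [Fintype X]

theorem mulVec_mem_span {B : Matrix X X ℂ} {s : Set (X → ℂ)}
    (h : ∀ w ∈ s, B *ᵥ w ∈ Submodule.span ℂ s) {w : X → ℂ} (hw : w ∈ Submodule.span ℂ s) :
    B *ᵥ w ∈ Submodule.span ℂ s :=
  (Submodule.span_le (p := (Submodule.span ℂ s).comap B.mulVecLin)).2 h hw

variable [DecidableEq X]

theorem mem_eigenvalueSet {t : ℝ} :
    t ∈ eigenvalueSet G ↔ ∃ w : X → ℂ, w ≠ 0 ∧ adjacency G *ᵥ w = (t : ℂ) • w := by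
  rw [eigenvalueSet, Set.Finite.mem_toFinset]
  constructor
  · intro h
    obtain ⟨w, hw⟩ := Module.End.HasEigenvalue.exists_hasEigenvector h
    exact ⟨w, hw.2, by simpa using hw.apply_eq_smul⟩
  · rintro ⟨w, hw0, hw⟩
    exact Module.End.hasEigenvalue_of_hasEigenvector
      ⟨Module.End.mem_eigenspace_iff.2 (by simpa using hw), hw0⟩

theorem sum_eigenprojection (G : SimpleGraph X) :
    ∑ t ∈ eigenvalueSet G, eigenprojection (adjacency G) t = 1 := by
  refine ext_of_mulVec_eigenvector (isHermitian_adjacency G) fun t w hw0 hw => ?_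
  rw [Matrix.sum_mulVec, Finset.sum_eq_single_of_mem t (mem_eigenvalueSet.2 ⟨w, hw0, hw⟩),
    eigenprojection_mulVec_of_eigenvector hw, Matrix.one_mulVec]
  exact fun s _ hst => eigenprojection_mulVec_of_ne (isHermitian_adjacency G)
    (Complex.ofReal_injective.ne hst.symm) hw

theorem eigenprojection_mem_boseMesner {t : ℝ} (ht : t ∈ eigenvalueSet G) :
    eigenprojection (adjacency G) t ∈ boseMesner G := by
  have hinj : Set.InjOn ((↑) : ℝ → ℂ) (eigenvalueSet G) := Complex.ofReal_injective.injOn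
  suffices h : eigenprojection (adjacency G) t =
      Polynomial.aeval (adjacency G) (Lagrange.basis (eigenvalueSet G) ((↑) : ℝ → ℂ) t) from
    h ▸ Polynomial.aeval_mem_adjoin_singleton ℂ _
  refine ext_of_mulVec_eigenvector (isHermitian_adjacency G) fun s w hw0 hw => ?_
  rw [aeval_mulVec_of_eigenvector hw]
  obtain rfl | hst := eq_or_ne s t
  · rw [eigenprojection_mulVec_of_eigenvector hw, Lagrange.eval_basis_self hinj ht, one_smul]
  · rw [eigenprojection_mulVec_of_ne (isHermitian_adjacency G) (Complex.ofReal_injective.ne hst) hw,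
      Lagrange.eval_basis_of_ne hst.symm (mem_eigenvalueSet.2 ⟨w, hw0, hw⟩), zero_smul]

theorem self_mem_boseMesnerSpan (v : X → ℂ) : v ∈ boseMesnerSpan G v :=
  ⟨1, (boseMesner G).one_mem, Matrix.one_mulVec v⟩

theorem adjacency_mulVec_mem_boseMesnerSpan {v w : X → ℂ} (hw : w ∈ boseMesnerSpan G v) :
    adjacency G *ᵥ w ∈ boseMesnerSpan G v := by
  obtain ⟨B, hB, rfl⟩ := hw
  exact ⟨adjacency G * B, (boseMesner G).mul_mem (Algebra.self_mem_adjoin_singleton ℂ _) hB,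
    (Matrix.mulVec_mulVec v (adjacency G) B).symm⟩

theorem mulVec_mem_of_mem_adjoin {s : Set (Matrix X X ℂ)} {W : Submodule ℂ (X → ℂ)}
    (hs : ∀ B ∈ s, ∀ w ∈ W, B *ᵥ w ∈ W) {B : Matrix X X ℂ} (hB : B ∈ Algebra.adjoin ℂ s) :
    ∀ w ∈ W, B *ᵥ w ∈ W := by
  induction hB using Algebra.adjoin_induction with
  | mem B hB => exact hs B hB
  | algebraMap a =>
    intro w hw
    rw [Algebra.algebraMap_eq_smul_one, Matrix.smul_mulVec, Matrix.one_mulVec]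
    exact W.smul_mem a hw
  | add B C _ _ hB hC => exact fun w hw => Matrix.add_mulVec B C w ▸ W.add_mem (hB w hw) (hC w hw)
  | mul B C _ _ hB hC => exact fun w hw => Matrix.mulVec_mulVec w B C ▸ hB _ (hC w hw)

theorem boseMesnerSpan_le {W : Submodule ℂ (X → ℂ)} (hW : ∀ w ∈ W, adjacency G *ᵥ w ∈ W)
    {v : X → ℂ} (hv : v ∈ W) : boseMesnerSpan G v ≤ W := by
  rintro _ ⟨B, hB, rfl⟩
  exact mulVec_mem_of_mem_adjoin (by rintro _ rfl; exact hW) hB v hv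

theorem span_eigenprojection_mulVec (v : X → ℂ) :
    Submodule.span ℂ ((fun t : ℝ => eigenprojection (adjacency G) t *ᵥ v) '' eigenvalueSet G) =
      boseMesnerSpan G v := by
  refine le_antisymm ?_ (boseMesnerSpan_le (fun w hw => mulVec_mem_span ?_ hw) ?_)
  · rw [Submodule.span_le]
    rintro _ ⟨t, ht, rfl⟩
    exact ⟨_, eigenprojection_mem_boseMesner ht, rfl⟩
  · rintro _ ⟨t, ht, rfl⟩
    rw [mulVec_eigenprojection_mulVec]
    exact Submodule.smul_mem _ _ (Submodule.subset_span ⟨t, ht, rfl⟩)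
  · have hmem := Submodule.sum_mem (Submodule.span ℂ
      ((fun t : ℝ => eigenprojection (adjacency G) t *ᵥ v) '' eigenvalueSet G))
      fun t ht => Submodule.subset_span (Set.mem_image_of_mem _ ht)
    rwa [← Matrix.sum_mulVec, sum_eigenprojection, Matrix.one_mulVec] at hmem

end Spectral

section EigenprojectionProfile

variable {X : Type*} [Fintype X] [DecidableEq X] {G : SimpleGraph X}

theorem IsDistanceRegular.exists_hasProfile_eigenprojection (hG : IsDistanceRegular G) {t : ℝ}
    (ht : t ∈ eigenvalueSet G) :
    ∃ f : ℕ → ℝ, HasProfile G (eigenprojection (adjacency G) t) fun i => f i := by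
  obtain ⟨f, hf⟩ := hG.exists_hasProfile (eigenprojection_mem_boseMesner ht)
  refine ⟨fun i => (f i).re, fun y z => ?_⟩
  have hconj := (isHermitian_eigenprojection (adjacency G) t).apply y z
  rw [hf, hf, G.dist_comm] at hconj
  rw [hf]
  exact (Complex.conj_eq_iff_re.1 hconj).symm

open scoped ComplexOrder in
theorem HasProfile.apply_zero_pos [Nonempty X] {t : ℝ} (ht : t ∈ eigenvalueSet G) {f : ℕ → ℝ}
    (hf : HasProfile G (eigenprojection (adjacency G) t) fun i => f i) : 0 < f 0 := by
  have hdiag : ∀ y, (f 0 : ℂ) = star (Pi.single y (1 : ℂ)) ⬝ᵥ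
      (eigenprojection (adjacency G) t *ᵥ Pi.single y (1 : ℂ)) := fun y => by
    rw [Matrix.mulVec_single_one, ← Pi.single_star, star_one, single_one_dotProduct,
      Matrix.col_apply, hf, SimpleGraph.dist_self]
  have hnonneg : 0 ≤ f 0 := by
    obtain ⟨y⟩ := ‹Nonempty X›
    rw [← Complex.zero_le_real, hdiag y, star_dotProduct_eigenprojection_mulVec]
    exact dotProduct_star_self_nonneg _
  refine hnonneg.lt_of_ne' fun h0 => ?_
  have hE : eigenprojection (adjacency G) t = 0 := Matrix.ext_of_mulVec_single fun y => by
    rw [Matrix.zero_mulVec]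
    refine eigenprojection_mulVec_eq_zero_of_star_dotProduct ?_
    rw [← hdiag, h0, Complex.ofReal_zero]
  obtain ⟨w, hw0, hw⟩ := mem_eigenvalueSet.1 ht
  rw [← eigenprojection_mulVec_of_eigenvector hw, hE, Matrix.zero_mulVec] at hw0
  exact hw0 rfl

theorem HasProfile.recurrence (hG : IsDistanceRegular G) (hbip : G.IsBipartite) {t : ℝ}
    {f : ℕ → ℝ} (hf : HasProfile G (eigenprojection (adjacency G) t) fun i => f i) {i : ℕ}
    (hi : i ≤ G.diam) : t * f i = c G i * f (i - 1) + b G i * f (i + 1) := by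
  obtain ⟨y, z, h⟩ := exists_dist_eq hG.1 hi
  have hentry := congrFun (mulVec_eigenprojection_mulVec (adjacency G) t (Pi.single z 1)) y
  simp only [adjacency_mulVec_apply, Matrix.mulVec_single_one, Pi.smul_apply, Matrix.col_apply,
    hf _ z, smul_eq_mul, h] at hentry
  rw [← hG.sum_neighbors hbip f h]
  exact_mod_cast hentry.symm

section InitialValues

variable (hG : IsDistanceRegular G) (hbip : G.IsBipartite) {t : ℝ} {f : ℕ → ℝ}
  (hf : HasProfile G (eigenprojection (adjacency G) t) fun i => f i)
include hG hbip hf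

theorem HasProfile.recurrence_zero : t * f 0 = b G 0 * f 1 := by
  have hc : c G 0 = 0 := Nat.add_eq_right.1 (hG.c_add_b hbip G.diam.zero_le)
  simpa [hc] using hf.recurrence hG hbip G.diam.zero_le

theorem HasProfile.zero_sub_two (hD : 1 ≤ G.diam) :
    b G 0 * b G 1 * (f 0 - f 2) = ((b G 0 : ℝ) ^ 2 - t ^ 2) * f 0 := by
  have hb1 : (1 + b G 1 : ℝ) = b G 0 := by exact_mod_cast hG.one_add_b_one hbip hD
  have h0 := hf.recurrence_zero hG hbip
  have h1 := hf.recurrence hG hbip hD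
  rw [hG.c_one hD, Nat.cast_one, one_mul] at h1
  linear_combination (b G 0 : ℝ) * f 0 * hb1 + (b G 0 : ℝ) * h1 + t * h0

theorem HasProfile.two_sub_four (hD : 3 ≤ G.diam) :
    b G 0 * b G 1 * (b G 2 * b G 3) * (f 2 - f 4) =
      ((b G 0 : ℝ) ^ 2 - t ^ 2) * (t ^ 2 - b G 2) * f 0 := by
  have hb1 : (1 + b G 1 : ℝ) = b G 0 := by exact_mod_cast hG.one_add_b_one hbip (by omega)
  have hcb2 : (c G 2 + b G 2 : ℝ) = b G 0 := by exact_mod_cast hG.c_add_b hbip (by omega)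
  have hcb3 : (c G 3 + b G 3 : ℝ) = b G 0 := by exact_mod_cast hG.c_add_b hbip hD
  have h0 := hf.recurrence_zero hG hbip
  have h02 := hf.zero_sub_two hG hbip (by omega)
  have h2 := hf.recurrence hG hbip (i := 2) (by omega)
  have h3 := hf.recurrence hG hbip hD
  simp only [Nat.reduceSub, Nat.reduceAdd] at h2 h3
  have h24 : b G 2 * b G 3 * (f 2 - f 4) = (b G 0 * b G 2 - t ^ 2) * f 2 + t * c G 2 * f 1 := by
    linear_combination (b G 2 : ℝ) * h3 + (b G 2 : ℝ) * f 2 * hcb3 + t * h2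
  linear_combination (b G 0 * b G 1 : ℝ) * h24 + t * b G 0 * b G 1 * f 1 * hcb2 -
    (b G 0 * b G 2 - t ^ 2) * h02 - t * (b G 0 - b G 2) * b G 1 * h0 +
    b G 2 * ((b G 0 : ℝ) ^ 2 - t ^ 2) * f 0 * hb1

end InitialValues

end EigenprojectionProfile

section SortedList

variable {α : Type*} [LinearOrder α]

theorem strictAntiOn_getD_sort (S : Finset α) (a : α) :
    StrictAntiOn (fun i => (S.sort (· ≥ ·)).getD i a) (Set.Iio #S) := by
  intro i hi j hj hij
  rw [Set.mem_Iio, ← Finset.length_sort (· ≥ ·)] at hi hj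
  simp only [List.getD_eq_getElem _ _ hi, List.getD_eq_getElem _ _ hj]
  exact List.pairwise_iff_getElem.1 (Finset.sortedGT_sort S).pairwise i j hi hj hij

theorem image_getD_sort (S : Finset α) (a : α) :
    (fun i => (S.sort (· ≥ ·)).getD i a) '' Set.Iio #S = S := by
  ext t
  simp only [Set.mem_image, Set.mem_Iio, Finset.mem_coe]
  rw [← Finset.mem_sort (· ≥ ·), List.mem_iff_getElem, ← Finset.length_sort (· ≥ ·)]
  constructor
  · rintro ⟨i, hi, rfl⟩
    exact ⟨i, hi, (List.getD_eq_getElem _ _ hi).symm⟩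
  · rintro ⟨i, hi, rfl⟩
    exact ⟨i, hi, List.getD_eq_getElem _ _ hi⟩

end SortedList

section Eigenvalues

variable {X : Type*} [Fintype X] [DecidableEq X] {G : SimpleGraph X}

theorem adjacency_pow_apply (j : ℕ) (y z : X) :
    (adjacency G ^ j) y z = Nat.card {p : G.Walk y z | p.length = j} := by
  classical
  have h : adjacency G = G.adjMatrix ℂ := by
    ext y z
    simp [adjacency, distMatrix, SimpleGraph.adjMatrix_apply]
  rw [h, SimpleGraph.adjMatrix_pow_apply_eq_card_walk, Nat.card_eq_fintype_card]

theorem adjacency_pow_apply_of_lt {j : ℕ} {y z : X} (h : j < G.dist y z) :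
    (adjacency G ^ j) y z = 0 := by
  have : IsEmpty {p : G.Walk y z | p.length = j} :=
    ⟨fun ⟨p, hp⟩ => ((SimpleGraph.dist_le p).trans_eq hp).not_gt h⟩
  rw [adjacency_pow_apply, Nat.card_of_isEmpty, Nat.cast_zero]

theorem adjacency_pow_dist_apply_ne_zero (hG : G.Connected) (y z : X) :
    (adjacency G ^ G.dist y z) y z ≠ 0 := by
  classical
  obtain ⟨p, hp⟩ := hG.exists_walk_length_eq_dist y z
  have : Nonempty {p : G.Walk y z | p.length = G.dist y z} := ⟨⟨p, hp⟩⟩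
  rw [adjacency_pow_apply, Nat.cast_ne_zero]
  exact Nat.card_pos.ne'

theorem diam_lt_natDegree_of_aeval_adjacency_eq_zero (hG : G.Connected) {p : Polynomial ℂ}
    (hp : p.Monic) (h0 : Polynomial.aeval (adjacency G) p = 0) : G.diam < p.natDegree := by
  by_contra! hle
  obtain ⟨y, z, h⟩ := exists_dist_eq hG hle
  refine adjacency_pow_dist_apply_ne_zero hG y z ?_
  have hyz := congrFun (congrFun h0 y) z
  rwa [Polynomial.aeval_eq_sum_range, Matrix.sum_apply, Finset.sum_range_succ,
    Finset.sum_eq_zero fun j hj => ?_, zero_add, hp.coeff_natDegree, one_smul, ← h] at hyz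
  rw [Matrix.smul_apply, adjacency_pow_apply_of_lt (h ▸ Finset.mem_range.1 hj), smul_zero]

theorem diam_lt_card_eigenvalueSet (hG : G.Connected) : G.diam < #(eigenvalueSet G) := by
  let p : Polynomial ℂ := ∏ t ∈ eigenvalueSet G, (Polynomial.X - Polynomial.C (t : ℂ))
  have hp : p.Monic := Polynomial.monic_prod_X_sub_C _ _
  have hdeg : p.natDegree = #(eigenvalueSet G) :=
    Polynomial.natDegree_finsetProd_X_sub_C_eq_card _ _
  rw [← hdeg]
  refine diam_lt_natDegree_of_aeval_adjacency_eq_zero hG hp ?_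
  refine ext_of_mulVec_eigenvector (isHermitian_adjacency G) fun t w hw0 hw => ?_
  have ht : p.eval (t : ℂ) = 0 := by
    rw [Polynomial.eval_prod]
    exact Finset.prod_eq_zero (mem_eigenvalueSet.2 ⟨w, hw0, hw⟩) (by simp)
  rw [aeval_mulVec_of_eigenvector hw, ht, zero_smul, Matrix.zero_mulVec]

theorem linearIndependent_eigenprojection_mulVec {ι : Type*} {t : ι → ℝ}
    (ht : Function.Injective t) {v : X → ℂ}
    (h0 : ∀ i, eigenprojection (adjacency G) (t i) *ᵥ v ≠ 0) :
    LinearIndependent ℂ fun i => eigenprojection (adjacency G) (t i) *ᵥ v :=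
  Module.End.eigenvectors_linearIndependent' (Matrix.toLin' (adjacency G)) (fun i => (t i : ℂ))
    (Complex.ofReal_injective.comp ht) _ fun i =>
      ⟨Module.End.mem_eigenspace_iff.2 (mulVec_eigenprojection_mulVec _ _ _), h0 i⟩

theorem card_eigenvalueSet_le (hG : IsDistanceRegular G) : #(eigenvalueSet G) ≤ G.diam + 1 := by
  obtain ⟨x⟩ := hG.1.nonempty
  choose f hf using fun t : eigenvalueSet G => hG.exists_hasProfile_eigenprojection t.2
  let u : eigenvalueSet G → X → ℂ := fun t => eigenprojection (adjacency G) t *ᵥ Pi.single x 1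
  have hu : ∀ t y, u t y = f t (G.dist y x) := fun t y => by
    simp only [u, Matrix.mulVec_single_one, Matrix.col_apply, hf t y x]
  have hli : LinearIndependent ℂ u :=
    linearIndependent_eigenprojection_mulVec Subtype.coe_injective fun t h0 => by
      have : Nonempty X := ⟨x⟩
      have h := (hu t x).symm.trans (congrFun h0 x)
      rw [SimpleGraph.dist_self, Pi.zero_apply, Complex.ofReal_eq_zero] at h
      exact ((hf t).apply_zero_pos t.2).ne' h
  let distFun : (Fin (G.diam + 1) → ℂ) →ₗ[ℂ] (X → ℂ) :=
    LinearMap.funLeft ℂ ℂ fun y => ⟨G.dist y x, Nat.lt_succ_of_le (dist_le_diam hG.1 y x)⟩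
  have hrange : Submodule.span ℂ (Set.range u) ≤ distFun.range := by
    rw [Submodule.span_le]
    rintro _ ⟨t, rfl⟩
    exact ⟨fun i => f t i, funext fun y => (hu t y).symm⟩
  calc #(eigenvalueSet G) = Module.finrank ℂ (Submodule.span ℂ (Set.range u)) := by
        rw [finrank_span_eq_card hli, Fintype.card_coe]
    _ ≤ Module.finrank ℂ distFun.range := Submodule.finrank_mono hrange
    _ ≤ G.diam + 1 := distFun.finrank_range_le.trans_eq (Module.finrank_fin_fun ℂ)

theorem card_eigenvalueSet (hG : IsDistanceRegular G) : #(eigenvalueSet G) = G.diam + 1 :=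
  le_antisymm (card_eigenvalueSet_le hG) (diam_lt_card_eigenvalueSet hG.1)

theorem Iio_card_eigenvalueSet (hG : IsDistanceRegular G) :
    Set.Iio #(eigenvalueSet G) = Set.Iic G.diam := by
  rw [card_eigenvalueSet hG, ← Order.succ_eq_add_one, Order.Iio_succ]

theorem strictAntiOn_eigenvalue (hG : IsDistanceRegular G) :
    StrictAntiOn (eigenvalue G) (Set.Iic G.diam) :=
  Iio_card_eigenvalueSet hG ▸ strictAntiOn_getD_sort (eigenvalueSet G) 0

theorem image_eigenvalue (hG : IsDistanceRegular G) :
    eigenvalue G '' Set.Iic G.diam = eigenvalueSet G :=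
  Iio_card_eigenvalueSet hG ▸ image_getD_sort (eigenvalueSet G) 0

theorem eigenvalue_mem (hG : IsDistanceRegular G) {i : ℕ} (hi : i ≤ G.diam) :
    eigenvalue G i ∈ eigenvalueSet G :=
  (image_eigenvalue hG).subset (Set.mem_image_of_mem _ hi)

theorem exists_eigenvalue_eq (hG : IsDistanceRegular G) {t : ℝ} (ht : t ∈ eigenvalueSet G) :
    ∃ i ≤ G.diam, eigenvalue G i = t :=
  (image_eigenvalue hG).superset ht

theorem neg_mem_eigenvalueSet (hbip : G.IsBipartite) {t : ℝ} (ht : t ∈ eigenvalueSet G) :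
    -t ∈ eigenvalueSet G := by
  let C : G.Coloring Bool := hbip.toColoring (by simp)
  let sign : X → ℂ := fun y => if C y then 1 else -1
  have hsign : ∀ y, sign y * sign y = 1 := fun y => by simp only [sign]; split_ifs <;> simp
  obtain ⟨w, hw0, hw⟩ := mem_eigenvalueSet.1 ht
  refine mem_eigenvalueSet.2 ⟨sign * w, fun h0 => hw0 ?_, funext fun y => ?_⟩
  · rw [← one_mul w, ← show sign * sign = 1 from funext hsign, mul_assoc, h0, mul_zero]
  · have hflip : ∀ z ∈ ({z | G.dist y z = 1} : Finset X), (sign * w) z = -sign y * w z := by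
      intro z hz
      have hyz : C y ≠ C z :=
        C.valid (SimpleGraph.dist_eq_one_iff_adj.1 (Finset.mem_filter.1 hz).2)
      cases hy : C y <;> cases hz : C z <;> simp_all [sign]
    rw [adjacency_mulVec_apply, Finset.sum_congr rfl hflip, ← Finset.mul_sum,
      ← adjacency_mulVec_apply, hw]
    simp only [Pi.smul_apply, Pi.mul_apply, smul_eq_mul, Complex.ofReal_neg]
    ring

theorem eigenvalue_diam_sub (hG : IsDistanceRegular G) (hbip : G.IsBipartite) {i : ℕ}
    (hi : i ≤ G.diam) : eigenvalue G (G.diam - i) = -eigenvalue G i := by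
  let θ : Set.Iic G.diam → ℝ := fun i => eigenvalue G i
  let rev : Set.Iic G.diam → Set.Iic G.diam := fun i => ⟨G.diam - i, Nat.sub_le _ _⟩
  have hθ : StrictAnti θ := fun i j hij => strictAntiOn_eigenvalue hG i.2 j.2 hij
  have hrev : StrictAnti rev := fun i j (hij : i.1 < j.1) =>
    show G.diam - j < G.diam - i from Nat.sub_lt_sub_left (hij.trans_le j.2) hij
  have hmem : ∀ {t}, t ∈ Set.range θ ↔ t ∈ eigenvalueSet G := fun {t} => by
    rw [← Finset.mem_coe, ← image_eigenvalue hG, Set.image_eq_range]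
  have hrange : Set.range (θ ∘ rev) = Set.range (-θ) := by
    have hinv : Function.Involutive rev := fun i => Subtype.ext (Nat.sub_sub_self i.2)
    ext t
    rw [hinv.surjective.range_comp, hmem]
    refine ⟨fun ht => ?_, ?_⟩
    · obtain ⟨i, hi⟩ := hmem.2 (neg_mem_eigenvalueSet hbip ht)
      exact ⟨i, neg_eq_iff_eq_neg.2 hi⟩
    · rintro ⟨i, rfl⟩
      exact neg_mem_eigenvalueSet hbip (hmem.1 ⟨i, rfl⟩)
  exact congrFun ((StrictMono.range_inj (hθ.comp hrev) hθ.neg).1 hrange) ⟨i, hi⟩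

theorem eigenvalue_sq_eq_iff (hG : IsDistanceRegular G) (hbip : G.IsBipartite) {i j : ℕ}
    (hi : i ≤ G.diam) (hj : j ≤ G.diam) :
    eigenvalue G i ^ 2 = eigenvalue G j ^ 2 ↔ i = j ∨ i = G.diam - j := by
  have hinj := (strictAntiOn_eigenvalue hG).injOn
  rw [sq_eq_sq_iff_eq_or_eq_neg, ← eigenvalue_diam_sub hG hbip hj, hinj.eq_iff hi hj,
    hinj.eq_iff hi (Nat.sub_le _ _)]

theorem b_zero_mem_eigenvalueSet (hG : IsDistanceRegular G) : (b G 0 : ℝ) ∈ eigenvalueSet G := by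
  have := hG.1.nonempty
  refine mem_eigenvalueSet.2 ⟨1, one_ne_zero, funext fun y => ?_⟩
  simp [adjacency_mulVec_apply, hG.card_neighbors]

theorem abs_le_b_zero (hG : IsDistanceRegular G) {t : ℝ} (ht : t ∈ eigenvalueSet G) :
    |t| ≤ b G 0 := by
  obtain ⟨w, hw0, hw⟩ := mem_eigenvalueSet.1 ht
  obtain ⟨y₀, hy₀⟩ := Function.ne_iff.1 hw0
  have : Nonempty X := ⟨y₀⟩
  obtain ⟨y, hy⟩ := Finite.exists_max fun y => ‖w y‖
  have hpos : 0 < ‖w y‖ := (norm_pos_iff.2 hy₀).trans_le (hy y₀)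
  refine le_of_mul_le_mul_right ?_ hpos
  calc |t| * ‖w y‖ = ‖∑ z with G.dist y z = 1, w z‖ := by
        rw [← adjacency_mulVec_apply, hw, Pi.smul_apply, norm_smul, Complex.norm_real,
          Real.norm_eq_abs]
    _ ≤ ∑ z with G.dist y z = 1, ‖w y‖ := norm_sum_le_of_le _ fun z _ => hy z
    _ = b G 0 * ‖w y‖ := by rw [Finset.sum_const, hG.card_neighbors, nsmul_eq_mul]

theorem eigenvalue_zero (hG : IsDistanceRegular G) : eigenvalue G 0 = b G 0 := by
  have h0 : (0 : ℕ) ∈ Set.Iic G.diam := Nat.zero_le _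
  refine le_antisymm ((le_abs_self _).trans (abs_le_b_zero hG (eigenvalue_mem hG h0))) ?_
  obtain ⟨i, hi, h⟩ := exists_eigenvalue_eq hG (b_zero_mem_eigenvalueSet hG)
  exact h ▸ (strictAntiOn_eigenvalue hG).antitoneOn h0 hi (Nat.zero_le i)

end Eigenvalues

section SquaredEigenvalues

variable {X : Type*} [Fintype X] [DecidableEq X] {G : SimpleGraph X}

theorem sum_profile_eigenprojection_eq_zero (hG : G.Connected) {f : ℝ → ℕ → ℝ}
    (hf : ∀ t ∈ eigenvalueSet G,
      HasProfile G (eigenprojection (adjacency G) t) fun i => f t i)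
    {i : ℕ} (hi0 : i ≠ 0) (hi : i ≤ G.diam) : ∑ t ∈ eigenvalueSet G, f t i = 0 := by
  obtain ⟨y, z, rfl⟩ := exists_dist_eq hG hi
  have hyz : y ≠ z := fun h => hi0 (h ▸ SimpleGraph.dist_self)
  have hentry : ∑ t ∈ eigenvalueSet G, (f t (G.dist y z) : ℂ) = 0 := by
    rw [← Matrix.one_apply_ne hyz, ← sum_eigenprojection G, Matrix.sum_apply]
    exact Finset.sum_congr rfl fun t ht => (hf t ht y z).symm
  exact_mod_cast hentry

theorem sq_le_b_zero_sq (hG : IsDistanceRegular G) {t : ℝ} (ht : t ∈ eigenvalueSet G) :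
    t ^ 2 ≤ (b G 0 : ℝ) ^ 2 := by
  rw [sq_le_sq, Nat.abs_cast]
  exact abs_le_b_zero hG ht

variable (hG : IsDistanceRegular G) (hbip : G.IsBipartite)
include hG hbip

theorem exists_pos_weights_sum_eq_zero (hD : 4 ≤ G.diam) :
    ∃ r : ℝ → ℝ, (∀ t ∈ eigenvalueSet G, 0 < r t) ∧
      ∑ t ∈ eigenvalueSet G, ((b G 0 : ℝ) ^ 2 - t ^ 2) * (t ^ 2 - b G 2) * r t = 0 := by
  have := hG.1.nonempty
  choose! f hf using fun t (ht : t ∈ eigenvalueSet G) => hG.exists_hasProfile_eigenprojection ht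
  refine ⟨fun t => f t 0, fun t ht => (hf t ht).apply_zero_pos ht, ?_⟩
  rw [Finset.sum_congr rfl fun t ht => ((hf t ht).two_sub_four hG hbip (by omega)).symm,
    ← Finset.mul_sum, Finset.sum_sub_distrib,
    sum_profile_eigenprojection_eq_zero hG.1 hf two_ne_zero (by omega),
    sum_profile_eigenprojection_eq_zero hG.1 hf four_ne_zero hD, sub_zero, mul_zero]

theorem eigenvalue_half_nonneg : 0 ≤ eigenvalue G (G.diam / 2) := by
  have hle : eigenvalue G (G.diam - G.diam / 2) ≤ eigenvalue G (G.diam / 2) :=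
    (strictAntiOn_eigenvalue hG).antitoneOn (Nat.div_le_self _ _) (Nat.sub_le _ _) (by omega)
  rw [eigenvalue_diam_sub hG hbip (Nat.div_le_self _ _)] at hle
  linarith

theorem eigenvalue_sq_le_sq {i j : ℕ} (hij : i ≤ j) (hj : j ≤ G.diam / 2) :
    eigenvalue G j ^ 2 ≤ eigenvalue G i ^ 2 := by
  have hanti := (strictAntiOn_eigenvalue hG).antitoneOn
  have hjD : j ≤ G.diam := hj.trans (Nat.div_le_self _ _)
  have hj0 : 0 ≤ eigenvalue G j :=
    (eigenvalue_half_nonneg hG hbip).trans (hanti hjD (Nat.div_le_self _ _) hj)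
  exact pow_le_pow_left₀ hj0 (hanti (hij.trans hjD) hjD hij) 2

theorem exists_eigenvalue_sq_eq {t : ℝ} (ht : t ∈ eigenvalueSet G) :
    ∃ i ≤ G.diam / 2, eigenvalue G i ^ 2 = t ^ 2 := by
  obtain ⟨i, hi, rfl⟩ := exists_eigenvalue_eq hG ht
  rcases le_or_gt i (G.diam / 2) with hle | hgt
  · exact ⟨i, hle, rfl⟩
  · exact ⟨G.diam - i, by omega, by rw [eigenvalue_diam_sub hG hbip hi, neg_sq]⟩

theorem exists_mem_eigenvalueSet_sq_ne (hD : 4 ≤ G.diam) (a : ℝ) :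
    ∃ t ∈ eigenvalueSet G, t ^ 2 ≠ (b G 0 : ℝ) ^ 2 ∧ t ^ 2 ≠ a := by
  by_contra! h
  have heq : ∀ i, 0 < i → i < G.diam → eigenvalue G i ^ 2 = a := fun i hi0 hiD => by
    refine h _ (eigenvalue_mem hG hiD.le) ?_
    rw [← eigenvalue_zero hG, Ne, eigenvalue_sq_eq_iff hG hbip hiD.le (Nat.zero_le _)]
    omega
  have h12 := (heq 1 (by omega) (by omega)).trans (heq 2 (by omega) (by omega)).symm
  rw [eigenvalue_sq_eq_iff hG hbip (by omega) (by omega)] at h12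
  omega

variable (hD : 4 ≤ G.diam)
include hD

theorem exists_between_b_two_and_b_zero_sq :
    ∃ t ∈ eigenvalueSet G, (b G 2 : ℝ) < t ^ 2 ∧ t ^ 2 < (b G 0 : ℝ) ^ 2 := by
  obtain ⟨r, hr, hsum⟩ := exists_pos_weights_sum_eq_zero hG hbip hD
  obtain ⟨s, hs, hs0, hs2⟩ := exists_mem_eigenvalueSet_sq_ne hG hbip hD (b G 2)
  obtain ⟨t, ht, hpos⟩ := Finset.exists_pos_of_sum_zero_of_exists_nonzero _ hsum
    ⟨s, hs, mul_ne_zero (mul_ne_zero (sub_ne_zero.2 hs0.symm) (sub_ne_zero.2 hs2)) (hr s hs).ne'⟩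
  have hmul := (mul_pos_iff_of_pos_right (hr t ht)).1 hpos
  have h2 := pos_of_mul_pos_right hmul (sub_nonneg.2 (sq_le_b_zero_sq hG ht))
  exact ⟨t, ht, sub_pos.1 h2, sub_pos.1 ((mul_pos_iff_of_pos_right h2).1 hmul)⟩

theorem exists_sq_lt_b_two : ∃ t ∈ eigenvalueSet G, t ^ 2 < (b G 2 : ℝ) := by
  by_contra! h
  obtain ⟨r, hr, hsum⟩ := exists_pos_weights_sum_eq_zero hG hbip hD
  obtain ⟨t, ht, h2, h0⟩ := exists_between_b_two_and_b_zero_sq hG hbip hD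
  refine (Finset.sum_pos' (fun s hs => ?_) ⟨t, ht, ?_⟩).ne' hsum
  · exact mul_nonneg (mul_nonneg (sub_nonneg.2 (sq_le_b_zero_sq hG hs)) (sub_nonneg.2 (h s hs)))
      (hr s hs).le
  · exact mul_pos (mul_pos (sub_pos.2 h0) (sub_pos.2 h2)) (hr t ht)

theorem b_two_lt_eigenvalue_one_sq : (b G 2 : ℝ) < eigenvalue G 1 ^ 2 := by
  obtain ⟨t, ht, h2, h0⟩ := exists_between_b_two_and_b_zero_sq hG hbip hD
  obtain ⟨i, hi, hit⟩ := exists_eigenvalue_sq_eq hG hbip ht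
  have hi0 : i ≠ 0 := by
    rintro rfl
    exact h0.ne (by rw [← hit, eigenvalue_zero hG])
  exact h2.trans_le (hit ▸ eigenvalue_sq_le_sq hG hbip (Nat.one_le_iff_ne_zero.2 hi0) hi)

theorem eigenvalue_half_sq_lt_b_two : eigenvalue G (G.diam / 2) ^ 2 < (b G 2 : ℝ) := by
  obtain ⟨t, ht, h2⟩ := exists_sq_lt_b_two hG hbip hD
  obtain ⟨i, hi, hit⟩ := exists_eigenvalue_sq_eq hG hbip ht
  exact (eigenvalue_sq_le_sq hG hbip hi le_rfl).trans_lt (hit ▸ h2)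

theorem eigenvalue_sq_ne_b_two {n : ℕ} (hn : n = 1 ∨ n = G.diam / 2) :
    eigenvalue G n ^ 2 ≠ b G 2 := by
  rcases hn with rfl | rfl
  · exact (b_two_lt_eigenvalue_one_sq hG hbip hD).ne'
  · exact (eigenvalue_half_sq_lt_b_two hG hbip hD).ne

end SquaredEigenvalues

section Modules

variable {X : Type*} [Fintype X] [DecidableEq X] {G : SimpleGraph X} {x : X}

theorem dualIdempotent_mulVec_apply (j : ℕ) (w : X → ℂ) (y : X) :
    (dualIdempotent G x j *ᵥ w) y = if G.dist x y = j then w y else 0 := by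
  rw [dualIdempotent, Matrix.mulVec_diagonal, ite_mul, one_mul, zero_mul]

theorem dualIdempotent_mul_self (j : ℕ) :
    dualIdempotent G x j * dualIdempotent G x j = dualIdempotent G x j := by
  simp [dualIdempotent, Matrix.diagonal_mul_diagonal]

theorem dualIdempotent_mul_of_ne {i j : ℕ} (hij : i ≠ j) :
    dualIdempotent G x i * dualIdempotent G x j = 0 := by
  rw [dualIdempotent, dualIdempotent, Matrix.diagonal_mul_diagonal, Matrix.diagonal_eq_zero]
  ext y
  rw [Pi.zero_apply, mul_eq_zero, ite_eq_right_iff, ite_eq_right_iff]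
  by_contra! h
  exact hij (h.1.1.symm.trans h.2.1)

omit [Fintype X] in
theorem dualIdempotent_eq_zero_of_diam_lt [Finite X] (hG : G.Connected) {j : ℕ} (hj : G.diam < j) :
    dualIdempotent G x j = 0 := by
  rw [dualIdempotent, Matrix.diagonal_eq_zero]
  exact funext fun y => if_neg ((dist_le_diam hG x y).trans_lt hj).ne

theorem adjacency_mulVec_eq_sum_dualIdempotent (hG : G.Connected) {m : ℕ} {u : X → ℂ}
    (hu : dualIdempotent G x m *ᵥ u = u) :
    adjacency G *ᵥ u =
      ∑ j ∈ Finset.range (m + 2), dualIdempotent G x j *ᵥ (adjacency G *ᵥ u) := by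
  ext y
  simp only [Finset.sum_apply, dualIdempotent_mulVec_apply, Finset.sum_ite_eq, Finset.mem_range]
  split_ifs with hy
  · rfl
  · rw [adjacency_mulVec_apply]
    refine Finset.sum_eq_zero fun w hw => ?_
    have hyw : G.dist y w = 1 := (Finset.mem_filter.1 hw).2
    have hle : G.dist x y ≤ G.dist x w + G.dist w y := hG.dist_triangle
    rw [G.dist_comm (u := w), hyw] at hle
    rw [← hu, dualIdempotent_mulVec_apply, if_neg (by omega)]

variable {W : Submodule ℂ (X → ℂ)}

theorem IsTModule.adjacency_mulVec_mem (hW : IsTModule G x W) {w : X → ℂ} (hw : w ∈ W) :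
    adjacency G *ᵥ w ∈ W :=
  hW _ (le_sup_left (a := boseMesner G) (Algebra.self_mem_adjoin_singleton ℂ _)) w hw

theorem IsTModule.dualIdempotent_mulVec_mem (hW : IsTModule G x W) (j : ℕ) {w : X → ℂ}
    (hw : w ∈ W) : dualIdempotent G x j *ᵥ w ∈ W :=
  hW _ (le_sup_right (a := boseMesner G) (Algebra.subset_adjoin ⟨j, rfl⟩)) w hw

theorem isTModule_of_generators (hA : ∀ w ∈ W, adjacency G *ᵥ w ∈ W)
    (hE : ∀ j, ∀ w ∈ W, dualIdempotent G x j *ᵥ w ∈ W) : IsTModule G x W := by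
  intro B hB
  rw [subconstituentAlgebra, boseMesner, dualBoseMesner, ← Algebra.adjoin_union] at hB
  refine mulVec_mem_of_mem_adjoin ?_ hB
  rintro _ (rfl | ⟨j, rfl⟩)
  exacts [hA, hE j]

theorem IsTModule.mem_dualComponent (hW : IsTModule G x W) {j : ℕ} {w : X → ℂ} :
    w ∈ dualComponent G x j W ↔ w ∈ W ∧ dualIdempotent G x j *ᵥ w = w := by
  constructor
  · rintro ⟨u, hu, rfl⟩
    refine ⟨hW.dualIdempotent_mulVec_mem j hu, ?_⟩
    rw [Matrix.mulVecLin_apply, Matrix.mulVec_mulVec, dualIdempotent_mul_self]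
  · exact fun ⟨hw, h⟩ => ⟨w, hw, h⟩

theorem dualComponent_eq_bot_of_diam_lt (hG : G.Connected) {j : ℕ} (hj : G.diam < j) :
    dualComponent G x j W = ⊥ := by
  rw [dualComponent, dualIdempotent_eq_zero_of_diam_lt hG hj, Matrix.mulVecLin_zero,
    Submodule.map_zero]

theorem dualComponent_eq_bot_of_lt_endpoint (hG : G.Connected) {j : ℕ}
    (hj : j < endpoint G x W) : dualComponent G x j W = ⊥ := by
  rcases le_or_gt j G.diam with hle | hgt
  · by_contra hne
    exact Nat.notMem_of_lt_sInf hj ⟨hle, hne⟩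
  · exact dualComponent_eq_bot_of_diam_lt hG hgt

theorem IsThin.finrank_dualComponent_le_one (hG : G.Connected) (hthin : IsThin G x W) (j : ℕ) :
    Module.finrank ℂ (dualComponent G x j W) ≤ 1 := by
  rcases le_or_gt j G.diam with hle | hgt
  · exact hthin j hle
  · rw [dualComponent_eq_bot_of_diam_lt hG hgt, finrank_bot]
    exact zero_le_one

theorem IsThin.dualComponent_eq_span_singleton (hG : G.Connected) (hthin : IsThin G x W) {j : ℕ}
    {u : X → ℂ} (hu : u ∈ dualComponent G x j W) (hu0 : u ≠ 0) :
    dualComponent G x j W = Submodule.span ℂ {u} := by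
  refine (Submodule.eq_of_le_of_finrank_le ?_ ?_).symm
  · rwa [Submodule.span_singleton_le_iff_mem]
  · rw [finrank_span_singleton hu0]
    exact hthin.finrank_dualComponent_le_one hG j

end Modules

section Raising

variable {X : Type*} [Fintype X] [DecidableEq X] {G : SimpleGraph X} {x : X} {r : ℕ}

/-- The vectors obtained from `v ∈ E*_r W` by raising repeatedly: `u_0 = v` and
`u_{i+1} = E*_{r+i+1} A u_i`. For a thin irreducible module `W` with endpoint `r` they span `W`. -/
noncomputable def raise (G : SimpleGraph X) (x : X) (r : ℕ) (v : X → ℂ) : ℕ → X → ℂ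
  | 0 => v
  | i + 1 => dualIdempotent G x (r + i + 1) *ᵥ (adjacency G *ᵥ raise G x r v i)

theorem raise_eq_zero_of_le {v : X → ℂ} {m i : ℕ} (hmi : m ≤ i) (hm : raise G x r v m = 0) :
    raise G x r v i = 0 := by
  induction i, hmi using Nat.le_induction with
  | base => exact hm
  | succ i _ ih => rw [raise, ih, Matrix.mulVec_zero, Matrix.mulVec_zero]

theorem dualIdempotent_mulVec_raise {v : X → ℂ} (hv : dualIdempotent G x r *ᵥ v = v) (i : ℕ) :
    dualIdempotent G x (r + i) *ᵥ raise G x r v i = raise G x r v i := by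
  cases i with
  | zero => exact hv
  | succ i => rw [raise, ← add_assoc, Matrix.mulVec_mulVec, dualIdempotent_mul_self]

theorem span_range_raise {v : X → ℂ}
    (h : ∀ i, adjacency G *ᵥ raise G x r v i - raise G x r v (i + 1) ∈
      Submodule.span ℂ (raise G x r v '' Set.Iic i)) :
    Submodule.span ℂ (Set.range (raise G x r v)) = boseMesnerSpan G v := by
  refine le_antisymm (Submodule.span_le.2 ?_) (boseMesnerSpan_le (fun w hw => ?_) ?_)
  · rintro _ ⟨i, rfl⟩
    induction i using Nat.strong_induction_on with
    | h i ih =>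
      cases i with
      | zero => exact self_mem_boseMesnerSpan v
      | succ i =>
        have hle : Submodule.span ℂ (raise G x r v '' Set.Iic i) ≤ boseMesnerSpan G v := by
          rw [Submodule.span_le]
          rintro _ ⟨m, hm, rfl⟩
          exact ih m (Nat.lt_succ_of_le hm)
        rw [← sub_sub_cancel (adjacency G *ᵥ raise G x r v i) (raise G x r v (i + 1))]
        exact Submodule.sub_mem _ (adjacency_mulVec_mem_boseMesnerSpan (ih i i.lt_succ_self))
          (hle (h i))
  · refine mulVec_mem_span ?_ hw
    rintro _ ⟨i, rfl⟩
    rw [← sub_add_cancel (adjacency G *ᵥ raise G x r v i) (raise G x r v (i + 1))]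
    exact Submodule.add_mem _ (Submodule.span_mono (Set.image_subset_range _ _) (h i))
      (Submodule.subset_span ⟨i + 1, rfl⟩)
  · exact Submodule.subset_span ⟨0, rfl⟩

variable {W : Submodule ℂ (X → ℂ)}

theorem IsTModule.raise_mem (hW : IsTModule G x W) {v : X → ℂ} (hv : v ∈ W) (i : ℕ) :
    raise G x r v i ∈ W := by
  induction i with
  | zero => exact hv
  | succ i ih => exact hW.dualIdempotent_mulVec_mem _ (hW.adjacency_mulVec_mem ih)

theorem IsTModule.adjacency_mulVec_raise_sub_mem_span (hG : G.Connected) (hW : IsTModule G x W)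
    (hthin : IsThin G x W) {v : X → ℂ} (hv : v ∈ dualComponent G x (endpoint G x W) W) (i : ℕ) :
    adjacency G *ᵥ raise G x (endpoint G x W) v i - raise G x (endpoint G x W) v (i + 1) ∈
      Submodule.span ℂ (raise G x (endpoint G x W) v '' Set.Iic i) := by
  obtain ⟨hvW, hfix⟩ := hW.mem_dualComponent.1 hv
  rw [adjacency_mulVec_eq_sum_dualIdempotent hG (dualIdempotent_mulVec_raise hfix i),
    Finset.sum_range_succ, raise, add_sub_cancel_right]
  refine Submodule.sum_mem _ fun j hj => ?_
  have hjW : dualIdempotent G x j *ᵥ (adjacency G *ᵥ raise G x (endpoint G x W) v i) ∈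
      dualComponent G x j W := ⟨_, hW.adjacency_mulVec_mem (hW.raise_mem hvW i), rfl⟩
  rcases lt_or_ge j (endpoint G x W) with hlt | hge
  · rw [dualComponent_eq_bot_of_lt_endpoint hG hlt, Submodule.mem_bot] at hjW
    rw [hjW]
    exact Submodule.zero_mem _
  obtain ⟨m, rfl⟩ := Nat.exists_eq_add_of_le hge
  have hmi : m ≤ i := by
    rw [Finset.mem_range] at hj
    omega
  by_cases hm : raise G x (endpoint G x W) v m = 0
  · rw [raise_eq_zero_of_le hmi hm, Matrix.mulVec_zero, Matrix.mulVec_zero]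
    exact Submodule.zero_mem _
  · rw [hthin.dualComponent_eq_span_singleton hG
      (hW.mem_dualComponent.2 ⟨hW.raise_mem hvW m, dualIdempotent_mulVec_raise hfix m⟩) hm] at hjW
    have hsub : {raise G x (endpoint G x W) v m} ⊆ raise G x (endpoint G x W) v '' Set.Iic i :=
      Set.singleton_subset_iff.2 ⟨m, hmi, rfl⟩
    exact Submodule.span_mono hsub hjW

theorem IsIrreducibleTModule.eq_boseMesnerSpan (hG : G.Connected)
    (hW : IsIrreducibleTModule G x W) (hthin : IsThin G x W) {v : X → ℂ}
    (hv : v ∈ dualComponent G x (endpoint G x W) W) (hv0 : v ≠ 0) :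
    W = boseMesnerSpan G v := by
  obtain ⟨hT, -, hirr⟩ := hW
  obtain ⟨hvW, hfix⟩ := hT.mem_dualComponent.1 hv
  have hspan := span_range_raise (hT.adjacency_mulVec_raise_sub_mem_span hG hthin hv)
  have hdual : ∀ j, ∀ w ∈ boseMesnerSpan G v, dualIdempotent G x j *ᵥ w ∈ boseMesnerSpan G v := by
    rw [← hspan]
    refine fun j w hw => mulVec_mem_span ?_ hw
    rintro _ ⟨i, rfl⟩
    obtain rfl | hj := eq_or_ne j (endpoint G x W + i)
    · rw [dualIdempotent_mulVec_raise hfix]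
      exact Submodule.subset_span ⟨i, rfl⟩
    · rw [← dualIdempotent_mulVec_raise hfix, Matrix.mulVec_mulVec, dualIdempotent_mul_of_ne hj,
        Matrix.zero_mulVec]
      exact Submodule.zero_mem _
  have hMv : IsTModule G x (boseMesnerSpan G v) :=
    isTModule_of_generators (fun _ => adjacency_mulVec_mem_boseMesnerSpan) hdual
  refine ((hirr _ hMv (boseMesnerSpan_le (fun _ => hT.adjacency_mulVec_mem) hvW)).resolve_left
    fun hbot => hv0 ?_).symm
  exact (Submodule.mem_bot ℂ).1 (hbot ▸ self_mem_boseMesnerSpan v)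

end Raising

section LocalEigenvalue

variable {X : Type*} [Fintype X] [DecidableEq X] {G : SimpleGraph X} {x : X} {v : X → ℂ}

theorem sum_eq_zero_of_mem_dualComponent (hG : IsDistanceRegular G) {W : Submodule ℂ (X → ℂ)}
    (hW : IsTModule G x W) (hW0 : dualComponent G x 0 W = ⊥) {r : ℕ}
    (hv : v ∈ dualComponent G x r W) : ∑ z, v z = 0 := by
  by_contra hsum
  obtain ⟨hvW, hfix⟩ := hW.mem_dualComponent.1 hv
  have hvr : ∀ z, v z ≠ 0 → G.dist x z = r := fun z hz => by
    by_contra hne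
    rw [← hfix, dualIdempotent_mulVec_apply, if_neg hne] at hz
    exact hz rfl
  have hpow : adjacency G ^ r ∈ boseMesner G :=
    (boseMesner G).pow_mem (Algebra.self_mem_adjoin_singleton ℂ _) r
  obtain ⟨f, hf⟩ := hG.exists_hasProfile hpow
  have hfr : f r ≠ 0 := by
    obtain ⟨z, -, hz⟩ := Finset.exists_ne_zero_of_sum_ne_zero hsum
    rw [← hvr z hz, ← hf]
    exact hvr z hz ▸ adjacency_pow_dist_apply_ne_zero hG.1 x z
  have hx : (adjacency G ^ r *ᵥ v) x = f r * ∑ z, v z := by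
    rw [Matrix.mulVec, dotProduct, Finset.mul_sum]
    refine Finset.sum_congr rfl fun z _ => ?_
    obtain hz | hz := eq_or_ne (v z) 0
    · rw [hz, mul_zero, mul_zero]
    · rw [hf, hvr z hz]
  have hmem : dualIdempotent G x 0 *ᵥ (adjacency G ^ r *ᵥ v) ∈ dualComponent G x 0 W :=
    ⟨_, hW _ (le_sup_left (a := boseMesner G) hpow) v hvW, rfl⟩
  rw [hW0, Submodule.mem_bot] at hmem
  have hzero := congrFun hmem x
  rw [dualIdempotent_mulVec_apply, if_pos SimpleGraph.dist_self, hx] at hzero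
  exact mul_ne_zero hfr hsum hzero

theorem HasProfile.dualIdempotent_two_mulVec (hG : G.Connected) (hbip : G.IsBipartite)
    {B : Matrix X X ℂ} {f : ℕ → ℂ} (hB : HasProfile G B f) (hfix : dualIdempotent G x 2 *ᵥ v = v)
    (hsum : ∑ z, v z = 0) {η : ℂ}
    (hη : dualIdempotent G x 2 *ᵥ (distMatrix G 2 *ᵥ v) = η • v) :
    dualIdempotent G x 2 *ᵥ (B *ᵥ v) = (f 0 - f 4 + η * (f 2 - f 4)) • v := by
  have hv2 : ∀ z, G.dist x z ≠ 2 → v z = 0 := fun z hz => by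
    rw [← hfix, dualIdempotent_mulVec_apply, if_neg hz]
  ext y
  rw [dualIdempotent_mulVec_apply, Pi.smul_apply, smul_eq_mul]
  split_ifs with hy
  swap
  · rw [hv2 y hy, mul_zero]
  have hA2 : ∑ z, (if G.dist y z = 2 then v z else 0) = η * v y := by
    have h := congrFun hη y
    rw [dualIdempotent_mulVec_apply, if_pos hy] at h
    simpa [Matrix.mulVec, dotProduct, distMatrix] using h
  have hterm : ∀ z, B y z * v z = (f 0 - f 4) * (if z = y then v z else 0) +
      (f 2 - f 4) * (if G.dist y z = 2 then v z else 0) + f 4 * v z := by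
    intro z
    by_cases hz : G.dist x z = 2
    · have hle : G.dist y z ≤ G.dist y x + G.dist x z := hG.dist_triangle
      rw [G.dist_comm (u := y) (v := x), hy, hz] at hle
      have heven := even_dist_of_dist_eq hG hbip (hy.trans hz.symm)
      have h024 : G.dist y z = 0 ∨ G.dist y z = 2 ∨ G.dist y z = 4 := by grind
      have hzy : z = y ↔ G.dist y z = 0 := by rw [hG.dist_eq_zero_iff, eq_comm]
      simp only [hB y z, hzy]
      rcases h024 with h | h | h <;> simp only [h] <;> norm_num <;> ring
    · simp [hv2 z hz]
  rw [Matrix.mulVec, dotProduct, Finset.sum_congr rfl fun z _ => hterm z, Finset.sum_add_distrib,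
    Finset.sum_add_distrib, ← Finset.mul_sum, ← Finset.mul_sum, ← Finset.mul_sum, hA2, hsum,
    Finset.sum_ite_eq' Finset.univ y v, if_pos (Finset.mem_univ _)]
  ring

theorem star_dotProduct_dualIdempotent_mulVec {j : ℕ} (hfix : dualIdempotent G x j *ᵥ v = v)
    (w : X → ℂ) : star v ⬝ᵥ (dualIdempotent G x j *ᵥ w) = star v ⬝ᵥ w := by
  have hherm : (dualIdempotent G x j).IsHermitian :=
    Matrix.isHermitian_diagonal_of_self_adjoint _ (funext fun y => by simp [apply_ite])
  rw [Matrix.dotProduct_mulVec]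
  nth_rw 1 [← hherm.eq]
  rw [← Matrix.star_mulVec, hfix]

variable (hG : IsDistanceRegular G) (hbip : G.IsBipartite) (hD : 4 ≤ G.diam)
include hG hbip hD

theorem HasProfile.tilde_combination_eq_zero_iff {s t : ℝ} (hs : s ^ 2 ≠ b G 2)
    (ht : t ∈ eigenvalueSet G) {f : ℕ → ℝ}
    (hf : HasProfile G (eigenprojection (adjacency G) t) fun i => f i) :
    f 0 - f 4 + tilde G s * (f 2 - f 4) = 0 ↔ t ^ 2 = (b G 0 : ℝ) ^ 2 ∨ t ^ 2 = s ^ 2 := by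
  have := hG.1.nonempty
  have hs0 : s ^ 2 - b G 2 ≠ 0 := sub_ne_zero.2 hs
  have hb : ∀ i < 4, (b G i : ℝ) ≠ 0 := fun i hi =>
    Nat.cast_ne_zero.2 (hG.b_pos (by omega)).ne'
  have htilde : tilde G s * (s ^ 2 - b G 2) = -(s ^ 2 - b G 2) - b G 2 * b G 3 := by
    rw [tilde]
    field_simp
  have hprod : b G 0 * b G 1 * (s ^ 2 - b G 2) * (f 0 - f 4 + tilde G s * (f 2 - f 4)) =
      ((b G 0 : ℝ) ^ 2 - t ^ 2) * (s ^ 2 - t ^ 2) * f 0 := by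
    linear_combination (s ^ 2 - b G 2) * hf.zero_sub_two hG hbip (by omega) -
      hf.two_sub_four hG hbip (by omega) + (b G 0 * b G 1 : ℝ) * (f 2 - f 4) * htilde
  have hne : (b G 0 * b G 1 * (s ^ 2 - b G 2) : ℝ) ≠ 0 :=
    mul_ne_zero (mul_ne_zero (hb 0 (by norm_num)) (hb 1 (by norm_num))) hs0
  rw [← mul_right_inj' hne, mul_zero, hprod, mul_eq_zero, mul_eq_zero,
    or_iff_left (hf.apply_zero_pos ht).ne', sub_eq_zero, sub_eq_zero, eq_comm,
    eq_comm (a := s ^ 2)]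

variable {W : Submodule ℂ (X → ℂ)} (hW : IsTModule G x W) (hend : endpoint G x W = 2)
  (hv : v ∈ dualComponent G x 2 W) (hv0 : v ≠ 0)
include hW hend hv hv0

theorem eigenprojection_mulVec_eq_zero_iff {s t : ℝ} (hs : s ^ 2 ≠ b G 2)
    (hloc : HasLocalEigenvalue G x W (tilde G s)) (ht : t ∈ eigenvalueSet G) :
    eigenprojection (adjacency G) t *ᵥ v = 0 ↔ t ^ 2 = (b G 0 : ℝ) ^ 2 ∨ t ^ 2 = s ^ 2 := by
  obtain ⟨f, hf⟩ := hG.exists_hasProfile_eigenprojection ht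
  obtain ⟨-, hfix⟩ := hW.mem_dualComponent.1 hv
  have hsum : ∑ z, v z = 0 := sum_eq_zero_of_mem_dualComponent hG hW
    (dualComponent_eq_bot_of_lt_endpoint hG.1 (hend ▸ two_pos)) hv
  have hη : dualIdempotent G x 2 *ᵥ (distMatrix G 2 *ᵥ v) = (tilde G s : ℂ) • v := by
    rw [← hloc.2 v hv, ← Matrix.mulVec_mulVec, hfix, Matrix.mulVec_mulVec]
  have hcomp : dualIdempotent G x 2 *ᵥ (eigenprojection (adjacency G) t *ᵥ v) =
      ((f 0 - f 4 + tilde G s * (f 2 - f 4) : ℝ) : ℂ) • v := by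
    rw [hf.dualIdempotent_two_mulVec hG.1 hbip hfix hsum hη]
    push_cast
    rfl
  rw [← hf.tilde_combination_eq_zero_iff hG hbip hD hs ht]
  constructor
  · intro hE
    rw [hE, Matrix.mulVec_zero, eq_comm, smul_eq_zero, or_iff_left hv0] at hcomp
    exact_mod_cast hcomp
  · intro hzero
    apply eigenprojection_mulVec_eq_zero_of_star_dotProduct
    rw [← star_dotProduct_dualIdempotent_mulVec hfix, hcomp, hzero, Complex.ofReal_zero, zero_smul,
      dotProduct_zero]

theorem primitiveIdempotent_mulVec_eq_zero_iff {i n : ℕ} (hi : i ≤ G.diam) (hn : n ≤ G.diam)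
    (hθ : eigenvalue G n ^ 2 ≠ b G 2)
    (hloc : HasLocalEigenvalue G x W (tilde G (eigenvalue G n))) :
    primitiveIdempotent G i *ᵥ v = 0 ↔ i = 0 ∨ i = G.diam ∨ i = n ∨ i = G.diam - n := by
  refine (eigenprojection_mulVec_eq_zero_iff hG hbip hD hW hend hv hv0 hθ hloc
    (eigenvalue_mem hG hi)).trans ?_
  rw [← eigenvalue_zero hG, eigenvalue_sq_eq_iff hG hbip hi (Nat.zero_le _),
    eigenvalue_sq_eq_iff hG hbip hi hn, Nat.sub_zero, or_assoc]

end LocalEigenvalue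

section Basis

variable {X : Type*} [Fintype X] [DecidableEq X] {G : SimpleGraph X} {v : X → ℂ} {p : ℕ → Prop}

theorem linearIndependent_primitiveIdempotent_mulVec (hG : IsDistanceRegular G)
    (hp : ∀ i, p i → i ≤ G.diam) (h0 : ∀ i, p i → primitiveIdempotent G i *ᵥ v ≠ 0) :
    LinearIndependent ℂ fun i : {i // p i} => primitiveIdempotent G i *ᵥ v :=
  linearIndependent_eigenprojection_mulVec (t := fun i : {i // p i} => eigenvalue G i)
    (fun i j hij => Subtype.ext <|
      (strictAntiOn_eigenvalue hG).injOn (hp i i.2) (hp j j.2) hij) fun i => h0 i i.2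

theorem span_primitiveIdempotent_mulVec (hG : IsDistanceRegular G) (hp : ∀ i, p i → i ≤ G.diam)
    (h0 : ∀ i ≤ G.diam, ¬p i → primitiveIdempotent G i *ᵥ v = 0) :
    Submodule.span ℂ (Set.range fun i : {i // p i} => primitiveIdempotent G i *ᵥ v) =
      boseMesnerSpan G v := by
  rw [← span_eigenprojection_mulVec, ← image_eigenvalue hG, Set.image_image]
  refine le_antisymm (Submodule.span_mono ?_) (Submodule.span_le.2 ?_)
  · rintro _ ⟨i, rfl⟩
    exact ⟨i, hp i i.2, rfl⟩
  · rintro _ ⟨i, hi, rfl⟩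
    by_cases hpi : p i
    · exact Submodule.subset_span ⟨⟨i, hpi⟩, rfl⟩
    · exact Set.mem_of_eq_of_mem (h0 i hi hpi) (Submodule.zero_mem _)

end Basis

end DRG

theorem mainTheorem6_general {X : Type*} [Fintype X] [DecidableEq X] {G : SimpleGraph X}
    (hG : DRG.IsDistanceRegular G) (hbip : G.IsBipartite) (hD : 4 ≤ G.diam) {x : X} {n : ℕ}
    (hn : n ≤ G.diam) (hθ : DRG.eigenvalue G n ^ 2 ≠ DRG.b G 2)
    {W : Submodule ℂ (X → ℂ)} (hW : DRG.IsIrreducibleTModule G x W)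
    (hthin : DRG.IsThin G x W) (hend : DRG.endpoint G x W = 2)
    (hloc : DRG.HasLocalEigenvalue G x W (DRG.tilde G (DRG.eigenvalue G n)))
    {v : X → ℂ} (hv : v ∈ DRG.dualComponent G x 2 W) (hv0 : v ≠ 0) :
    W = DRG.boseMesnerSpan G v ∧
    LinearIndependent ℂ
      (fun i : {i : ℕ // 1 ≤ i ∧ i ≤ G.diam - 1 ∧ i ≠ n ∧ i ≠ G.diam - n} =>
        DRG.primitiveIdempotent G i *ᵥ v) ∧
    Submodule.span ℂ (Set.range
      (fun i : {i : ℕ // 1 ≤ i ∧ i ≤ G.diam - 1 ∧ i ≠ n ∧ i ≠ G.diam - n} =>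
        DRG.primitiveIdempotent G i *ᵥ v)) = W ∧
    DRG.primitiveIdempotent G 0 *ᵥ v = 0 ∧
    DRG.primitiveIdempotent G n *ᵥ v = 0 ∧
    DRG.primitiveIdempotent G (G.diam - n) *ᵥ v = 0 ∧
    DRG.primitiveIdempotent G G.diam *ᵥ v = 0 := by
  have hMv : W = DRG.boseMesnerSpan G v := hW.eq_boseMesnerSpan hG.1 hthin (hend.symm ▸ hv) hv0
  have hzero : ∀ i ≤ G.diam, DRG.primitiveIdempotent G i *ᵥ v = 0 ↔
      i = 0 ∨ i = G.diam ∨ i = n ∨ i = G.diam - n := fun i hi =>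
    DRG.primitiveIdempotent_mulVec_eq_zero_iff hG hbip hD hW.1 hend hv hv0 hi hn hθ hloc
  refine ⟨hMv, DRG.linearIndependent_primitiveIdempotent_mulVec hG (by omega) fun i hi => ?_,
    (DRG.span_primitiveIdempotent_mulVec hG (by omega) fun i hi hpi => ?_).trans hMv.symm,
    (hzero 0 (Nat.zero_le _)).2 (by tauto), (hzero n hn).2 (by tauto),
    (hzero _ (Nat.sub_le _ _)).2 (by tauto), (hzero _ le_rfl).2 (by tauto)⟩
  · rw [Ne, hzero i (by omega)]
    omega
  · rw [hzero i hi]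
    omega

theorem mainTheorem6 {X : Type*} [Fintype X] [DecidableEq X] (G : SimpleGraph X)
    [DecidableRel G.Adj] (hG : DRG.IsDistanceRegular G) (hbip : G.IsBipartite)
    (hD : 4 ≤ G.diam) (k : ℕ) (hreg : G.IsRegularOfDegree k) (hk : 3 ≤ k) (x : X)
    (n : ℕ) (hn : (Odd G.diam ∧ (n = 1 ∨ n = G.diam / 2)) ∨ (Even G.diam ∧ n = 1))
    (W : Submodule ℂ (X → ℂ)) (hW : DRG.IsIrreducibleTModule G x W)
    (hthin : DRG.IsThin G x W) (hend : DRG.endpoint G x W = 2)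
    (hloc : DRG.HasLocalEigenvalue G x W (DRG.tilde G (DRG.eigenvalue G n)))
    (v : X → ℂ) (hv : v ∈ DRG.dualComponent G x 2 W) (hv0 : v ≠ 0) :
    W = DRG.boseMesnerSpan G v ∧
    LinearIndependent ℂ
      (fun i : {i : ℕ // 1 ≤ i ∧ i ≤ G.diam - 1 ∧ i ≠ n ∧ i ≠ G.diam - n} =>
        DRG.primitiveIdempotent G i *ᵥ v) ∧
    Submodule.span ℂ (Set.range
      (fun i : {i : ℕ // 1 ≤ i ∧ i ≤ G.diam - 1 ∧ i ≠ n ∧ i ≠ G.diam - n} =>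
        DRG.primitiveIdempotent G i *ᵥ v)) = W ∧
    DRG.primitiveIdempotent G 0 *ᵥ v = 0 ∧
    DRG.primitiveIdempotent G n *ᵥ v = 0 ∧
    DRG.primitiveIdempotent G (G.diam - n) *ᵥ v = 0 ∧
    DRG.primitiveIdempotent G G.diam *ᵥ v = 0 :=
  mainTheorem6_general hG hbip hD (by omega)
    (DRG.eigenvalue_sq_ne_b_two hG hbip hD (by tauto)) hW hthin hend hloc hv hv0
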